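/- Let $n\in\mathbb{N}$, let $so(n)$ be the space of real skew-symmetric $n\times n$ matrices, and let $C$ be a real symmetric positive definite $n\times n$ matrix with pairwise distinct eigenvalues. Define $\mathcal{I}_C: so(n)\to so(n)$ by $\mathcal{I}_C\Omega=\Omega C+C\Omega$; this map is invertible because $C$ is positive definite. Then there exist $G^1,G^2\in so(n)$, depending only on $C$, such that for every damping coefficient $\nu\ge 0$ the controlled Euler–Frahm system $$\dot\Omega=\mathcal{I}_C^{-1}[C,\Omega^2]-\nu\,\Omega+G^1u_1(t)+G^2u_2(t),\qquad \Omega(t)\in so(n),$$ (where $[A,B]=AB-BA$) is globally controllable: for all $\tilde\Omega,\hat\Omega\in so(n)$ there are a time $T\ge 0$, bounded measurable controls $u_1,u_2:[0,T]\to\mathbb{R}$, and a (Carathéodory) solution $\Omega$ of the system on $[0,T]$ with $\Omega(0)=\tilde\Omega$ and $\Omega(T)=\hat\Omega$. -/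

import Mathlib

namespace RigidBody

section

attribute [local instance] LieRing.ofAssociativeRing

/-- `so(n)`, the space of real skew-symmetric `n × n` matrices: the underlying vector space of
Mathlib's orthogonal Lie algebra. -/
abbrev so (n : ℕ) : Submodule ℝ (Matrix (Fin n) (Fin n) ℝ) :=
  (LieAlgebra.Orthogonal.so (Fin n) ℝ).toSubmodule

theorem mem_so_iff {n : ℕ} (A : Matrix (Fin n) (Fin n) ℝ) : A ∈ so n ↔ A.transpose = -A :=
  LieAlgebra.Orthogonal.mem_so _ _ _

end

variable {n : ℕ} {C : Matrix (Fin n) (Fin n) ℝ}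

theorem transpose_eq_of_posDef (hC : C.PosDef) : C.transpose = C := by
  simpa [Matrix.IsHermitian, Matrix.conjTranspose_eq_transpose_of_trivial] using hC.isHermitian

/-- The inertia operator `Ω ↦ Ω C + C Ω` on `so(n)`. -/
def inertia (hC : C.PosDef) : so n →ₗ[ℝ] so n where
  toFun Ω := ⟨(Ω : Matrix (Fin n) (Fin n) ℝ) * C + C * (Ω : Matrix (Fin n) (Fin n) ℝ), by
    have h := (mem_so_iff _).1 Ω.2
    rw [mem_so_iff, Matrix.transpose_add, Matrix.transpose_mul,
      Matrix.transpose_mul, h, transpose_eq_of_posDef hC]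
    simp [add_comm]⟩
  map_add' A B := by
    ext1
    simp only [Submodule.coe_add, add_mul, mul_add]
    abel
  map_smul' a A := by
    ext1
    simp

/-- The inertia operator of a positive definite matrix is injective. -/
theorem inertia_injective (hC : C.PosDef) : Function.Injective (inertia hC) := by
  rw [injective_iff_map_eq_zero]
  intro Ω h
  have h0 : (Ω : Matrix (Fin n) (Fin n) ℝ) * C + C * (Ω : Matrix (Fin n) (Fin n) ℝ) = 0 :=
    congrArg Subtype.val h
  have hs := (mem_so_iff _).1 Ω.2
  apply Subtype.ext
  set A : Matrix (Fin n) (Fin n) ℝ := Ω.1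
  change A = 0
  have h1 : (A.transpose * C * A).trace = 0 := by
    have e1 : A * A * C + A * C * A = 0 := by
      have := congrArg (A * ·) h0
      simpa [mul_add, mul_assoc] using this
    have e2 : (A * A * C).trace = (A * C * A).trace := by
      rw [Matrix.mul_assoc, Matrix.trace_mul_comm]
    have e3 := congrArg Matrix.trace e1
    rw [Matrix.trace_add, e2, Matrix.trace_zero] at e3
    rw [hs, Matrix.neg_mul, Matrix.neg_mul, Matrix.trace_neg]
    linarith
  have h2 : (A.transpose * C * A).PosSemidef := by
    have := hC.posSemidef.conjTranspose_mul_mul_same A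
    rwa [Matrix.conjTranspose_eq_transpose_of_trivial] at this
  have h3 : A.transpose * C * A = 0 := h2.trace_eq_zero_iff.1 h1
  by_contra hne
  obtain ⟨j, hj⟩ : ∃ j, A.col j ≠ 0 := by
    by_contra! hall
    apply hne
    ext i j
    exact congrFun (hall j) i
  have h4 := hC.dotProduct_mulVec_pos hj
  have h5 : (A.transpose * C * A) j j = 0 := by rw [h3]; rfl
  rw [Matrix.mul_assoc, Matrix.mul_apply] at h5
  apply h4.ne'
  rw [← h5]
  simp [dotProduct, Matrix.mulVec, Matrix.mul_apply, Matrix.col_apply]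

/-- The inertia operator as a linear automorphism of `so(n)`; its inverse is
`(inertiaEquiv hC).symm`. -/
noncomputable def inertiaEquiv (hC : C.PosDef) : so n ≃ₗ[ℝ] so n :=
  LinearEquiv.ofBijective (inertia hC)
    ⟨inertia_injective hC, LinearMap.injective_iff_surjective.1 (inertia_injective hC)⟩

/-- The matrix commutator `[C, Ω²]`, an element of `so(n)`. -/
def commSq (hC : C.PosDef) (Ω : so n) : so n :=
  ⟨⁅C, (Ω : Matrix (Fin n) (Fin n) ℝ) ^ 2⁆, by
    have h := (mem_so_iff _).1 Ω.2
    rw [mem_so_iff, Ring.lie_def, Matrix.transpose_sub, Matrix.transpose_mul,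
      Matrix.transpose_mul, Matrix.transpose_pow, h, transpose_eq_of_posDef hC]
    simp⟩

/-- The right-hand side of the controlled Euler–Frahm equation with damping coefficient `ν`,
torque directions `G i` and control values `v i`. -/
noncomputable def eulerFrahm (hC : C.PosDef) (ν : ℝ) {r : ℕ} (G : Fin r → so n)
    (Ω : so n) (v : Fin r → ℝ) : so n :=
  (inertiaEquiv hC).symm (commSq hC Ω) - ν • Ω + ∑ i, v i • G i

/-- `Ω` is a trajectory on `[0, T]` of the controlled Euler–Frahm equation driven by the bounded
measurable control `u`: a Carathéodory solution, that is, a continuous curve satisfying the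
integrated equation (entry by entry) on `[0, T]`. -/
structure IsTrajectory (hC : C.PosDef) (ν : ℝ) {r : ℕ} (G : Fin r → so n) (T : ℝ)
    (u : ℝ → Fin r → ℝ) (Ω : ℝ → so n) : Prop where
  measurable_control : Measurable u
  bounded_control : ∃ b : ℝ, ∀ t ∈ Set.Icc 0 T, ∀ i, |u t i| ≤ b
  continuousOn : ContinuousOn Ω (Set.Icc 0 T)
  integral_eq : ∀ t ∈ Set.Icc 0 T, ∀ j k : Fin n,
    (Ω t : Matrix (Fin n) (Fin n) ℝ) j k = (Ω 0 : Matrix (Fin n) (Fin n) ℝ) j k +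
      ∫ s in (0 : ℝ)..t, (eulerFrahm hC ν G (Ω s) (u s) : Matrix (Fin n) (Fin n) ℝ) j k

/-- Global controllability: every state can be steered to every state in some time `T ≥ 0`. -/
def GloballyControllable (hC : C.PosDef) (ν : ℝ) {r : ℕ} (G : Fin r → so n) : Prop :=
  ∀ Ω₀ Ω₁ : so n, ∃ T : ℝ, 0 ≤ T ∧ ∃ (u : ℝ → Fin r → ℝ) (Ω : ℝ → so n),
    IsTrajectory hC ν G T u Ω ∧ Ω 0 = Ω₀ ∧ Ω T = Ω₁

end RigidBody

/-! The system has the form `x' = B(x, x) - ν x + v`, with `B` symmetric bilinear and `v` in the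
span of the torques. Call a direction `v` steerable if every `C¹` family of translations by `a(p) v`
can be realised up to errors that are small both in size and in the Lipschitz sense. Steerable
directions form a subspace containing the torques. If `v`, `w` are steerable and `B(v, v) = 0`, then
`B(v, w)` is steerable too (`IsReachability.bilin_mem_steerable`): displace the state by `ε⁻² v +
ε⁻¹ (a/2) w`, drift freely for time `ε³`, and undo the displacement. The cross term contributes
exactly `a B(v, w)`, while all other terms, damping included, are `O(ε)`. No recurrence of the drift
is needed, so every `ν` is allowed. Once all directions are steerable, the Lipschitz control of the
errors makes the target equation a contraction, so targets are hit exactly (`Steers.rel_of_id`).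

It remains to find two torques that generate `so(n)` under these brackets. In an eigenbasis of `C`
with eigenvalues `λ`, the plane rotations `Ω_ij` satisfy `B(Ω_ij, Ω_ij) = 0` and `B(Ω_ij, Ω_jk) =
(λ_i - λ_k) / (2 (λ_i + λ_k)) Ω_ik`. Take `Ω_ij` for the two largest eigenvalues, together with the
sum of the other `Ω_jk`. The square of `B(Ω_ij, ·)` is diagonal on these `Ω_jk` with distinct
eigenvalues, so it isolates each of them (`eq_top_of_torques_mem`), and brackets of the `Ω_jk` give
the rest. -/

namespace RigidBody

/-! ### Flows of small perturbations of constant vector fields -/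

section Perturbation

open Metric Set
open scoped NNReal

variable {E : Type*} [NormedAddCommGroup E] [NormedSpace ℝ E]

/-- Existence on `[0, 1]` of an integral curve that stays in a ball on which the vector field is
Lipschitz and bounded by the radius. -/
theorem exists_integralCurve_mem_closedBall [CompleteSpace E] {f : E → E} {x : E} {ρ K : ℝ≥0}
    (hf : LipschitzOnWith K f (closedBall x ρ)) (hb : ∀ y ∈ closedBall x ρ, ‖f y‖ ≤ ρ) :
    ∃ α : ℝ → E, α 0 = x ∧ ∀ t ∈ Icc (0 : ℝ) 1, α t ∈ closedBall x ρ ∧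
      HasDerivWithinAt α (f (α t)) (Icc 0 1) t := by
  have h : IsPicardLindelof (fun _ => f) (⟨0, by simp⟩ : Icc (0 : ℝ) 1) x ρ 0 ρ K :=
    { lipschitzOnWith := fun _ _ => hf
      continuousOn := fun _ _ => continuousOn_const
      norm_le := fun _ _ => hb
      mul_max_le := by simp }
  -- Taking the fixed point of the Picard operator itself retains the fact that the curve stays in
  -- the ball.
  obtain ⟨α, hα⟩ := ODE.FunSpace.exists_isFixedPt_next h (mem_closedBall_self le_rfl)
  refine ⟨α.compProj, ?_, fun t ht => ⟨α.compProj_mem_closedBall h.mul_max_le, ?_⟩⟩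
  · have : α.compProj ((⟨0, by simp⟩ : Icc (0 : ℝ) 1) : ℝ) = x := by
      rw [ODE.FunSpace.compProj_val, ← hα, ODE.FunSpace.next_apply₀]
    exact this
  · apply ODE.hasDerivWithinAt_picard_Icc (t₀ := 0) (by simp) h.continuousOn_uncurry
      α.continuous_compProj.continuousOn (fun _ _ => α.compProj_mem_closedBall h.mul_max_le)
      x ht |>.congr_of_mem _ ht
    intro t' ht'
    nth_rw 1 [← hα]
    rw [ODE.FunSpace.compProj_of_mem ht', ODE.FunSpace.next_apply]

/-- A `C¹` map is bounded and Lipschitz on every compact set, with a common constant. -/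
theorem exists_bound_and_lipschitz_of_isCompact {F G : Type*} [NormedAddCommGroup F]
    [NormedSpace ℝ F] [NormedAddCommGroup G] [NormedSpace ℝ G] {f : F → G} (hf : ContDiff ℝ 1 f)
    {s : Set F} (hs : IsCompact s) :
    ∃ K : ℝ≥0, (∀ x ∈ s, ‖f x‖ ≤ K) ∧ ∀ x ∈ s, ∀ y ∈ s, ‖f x - f y‖ ≤ K * ‖x - y‖ := by
  obtain ⟨K₁, hK₁⟩ := hs.exists_bound_of_continuousOn hf.continuous.continuousOn
  obtain ⟨K₂, hK₂⟩ :=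
    (hf.locallyLipschitz.locallyLipschitzOn (s := s)).exists_lipschitzOnWith_of_compact hs
  refine ⟨max K₁.toNNReal K₂, fun x hx => ?_, fun x hx y hy => ?_⟩
  · exact (hK₁ x hx).trans ((Real.le_coe_toNNReal _).trans (by simp))
  · refine (hK₂.norm_sub_le hx hy).trans ?_
    gcongr
    simp

/-- The time-one map of `y' = b p + ε g(ε, y, p)` is, for small `ε`, a perturbation of
`y ↦ y + b p` that is small in the Lipschitz sense, jointly in `y` and `p`. -/
theorem exists_perturbed_translation [FiniteDimensional ℝ E] {b : E → E} (hb : ContDiff ℝ 1 b)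
    {g : ℝ × (E × E) → E} (hg : ContDiff ℝ 1 g) (L : ℝ) {η : ℝ} (hη : 0 < η) :
    ∃ ε : ℝ, 0 < ε ∧ ∃ Y : E × E → ℝ → E,
      (∀ q, ‖q‖ ≤ L → Y q 0 = q.1 ∧
        (∀ s ∈ Icc (0 : ℝ) 1,
          HasDerivWithinAt (Y q) (b q.2 + ε • g (ε, (Y q s, q.2))) (Icc 0 1) s) ∧
        ‖Y q 1 - q.1 - b q.2‖ ≤ η) ∧
      ∀ q q', ‖q‖ ≤ L → ‖q'‖ ≤ L →
        ‖(Y q 1 - q.1 - b q.2) - (Y q' 1 - q'.1 - b q'.2)‖ ≤ η * ‖q - q'‖ := by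
  have : ProperSpace E := FiniteDimensional.proper ℝ E
  have : CompleteSpace E := FiniteDimensional.complete ℝ E
  obtain ⟨β, hβ, hβl⟩ := exists_bound_and_lipschitz_of_isCompact hb (isCompact_closedBall (0 : E) L)
  -- With speed at most `β + ε K ≤ β + 1`, a curve on `[0, 1]` stays within `β + 1` of its start,
  -- hence in the ball of radius `M`.
  set M : ℝ := L + β + 1 with hM
  obtain ⟨K, hK, hKl⟩ := exists_bound_and_lipschitz_of_isCompact hg
    ((isCompact_Icc (a := (0 : ℝ)) (b := 1)).prod (isCompact_closedBall (0 : E × E) M))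
  -- The bound `1/2` lets a term `ε K m` be absorbed into `m` below; the other bound makes the
  -- resulting Lipschitz constant at most `η`.
  set κ : ℝ := min (1 / 2) (η / (2 * (β + 3)))
  have hκpos : 0 < κ := by positivity
  set ε : ℝ := min 1 (κ / (K + 1))
  have hεpos : 0 < ε := by positivity
  have hε1 : ε ≤ 1 := min_le_left _ _
  have hεK : ε * K ≤ κ := by
    have h1 : ε * (K + 1) ≤ κ := by
      rw [← le_div_iff₀ (by positivity)]
      exact min_le_right _ _
    nlinarith
  have hεK2 : ε * K ≤ 1 / 2 := hεK.trans (min_le_left _ _)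
  have hεη : 2 * (β + 3) * (ε * K) ≤ η := by
    have h1 : ε * K ≤ η / (2 * (β + 3)) := hεK.trans (min_le_right _ _)
    rwa [le_div_iff₀ (by positivity), mul_comm] at h1
  have hεK0 : 0 ≤ ε * K := by positivity
  have hβ0 : (0 : ℝ) ≤ β := β.2
  have hεη' : ε * K ≤ η := by nlinarith
  have hmem : ∀ q : E × E, ‖q‖ ≤ L → ∀ y ∈ closedBall q.1 ((β + 1 : ℝ≥0) : ℝ),
      (ε, (y, q.2)) ∈ Icc (0 : ℝ) 1 ×ˢ closedBall (0 : E × E) M := by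
    intro q hq y hy
    refine ⟨⟨hεpos.le, hε1⟩, ?_⟩
    have h1 := norm_fst_le q
    have h2 := norm_snd_le q
    rw [mem_closedBall_iff_norm] at hy
    push_cast at hy
    have h3 : ‖y‖ ≤ ‖y - q.1‖ + ‖q.1‖ := by simpa using norm_add_le (y - q.1) q.1
    rw [mem_closedBall_zero_iff, Prod.norm_def]
    apply max_le <;> simp only [hM] <;> linarith
  have hsol : ∀ q : E × E, ‖q‖ ≤ L → ∃ α : ℝ → E, α 0 = q.1 ∧ ∀ t ∈ Icc (0 : ℝ) 1,
      α t ∈ closedBall q.1 ((β + 1 : ℝ≥0) : ℝ) ∧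
        HasDerivWithinAt α (b q.2 + ε • g (ε, (α t, q.2))) (Icc 0 1) t := by
    intro q hq
    refine exists_integralCurve_mem_closedBall
      (f := fun y => b q.2 + ε • g (ε, (y, q.2))) (K := ε.toNNReal * K) ?_ ?_
    · refine LipschitzOnWith.of_dist_le_mul fun y hy z hz => ?_
      rw [dist_eq_norm, dist_eq_norm, add_sub_add_left_eq_sub, ← smul_sub, norm_smul,
        Real.norm_of_nonneg hεpos.le]
      have h1 := hKl _ (hmem q hq y hy) _ (hmem q hq z hz)
      have h2 : ‖(ε, (y, q.2)) - (ε, (z, q.2))‖ = ‖y - z‖ := by simp [Prod.norm_def]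
      rw [h2] at h1
      push_cast
      rw [Real.coe_toNNReal _ hεpos.le, mul_assoc]
      gcongr
    · intro y hy
      refine (norm_add_le _ _).trans ?_
      rw [norm_smul, Real.norm_of_nonneg hεpos.le]
      push_cast
      have h1 := hβ q.2 (by simpa using (norm_snd_le q).trans hq)
      have h2 : ε * ‖g (ε, (y, q.2))‖ ≤ ε * K := by gcongr; exact hK _ (hmem q hq y hy)
      linarith
  choose! Y hY0 hY using hsol
  have hder : ∀ q : E × E, ‖q‖ ≤ L → ∀ s ∈ Icc (0 : ℝ) 1,
      HasDerivWithinAt (fun s => Y q s - s • b q.2) (ε • g (ε, (Y q s, q.2))) (Icc 0 1) s := by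
    intro q hq s hs
    have h1 := (hY q hq s hs).2.sub (((hasDerivAt_id s).smul_const (b q.2)).hasDerivWithinAt
      (s := Icc 0 1))
    rw [one_smul, add_sub_cancel_left] at h1
    exact h1
  refine ⟨ε, hεpos, Y, fun q hq => ⟨hY0 q hq, fun s hs => (hY q hq s hs).2, ?_⟩, ?_⟩
  · have h1 := norm_image_sub_le_of_norm_deriv_le_segment_01' (C := ε * K) (hder q hq) fun s hs => by
      rw [norm_smul, Real.norm_of_nonneg hεpos.le]
      gcongr
      exact hK _ (hmem q hq _ (hY q hq s (Ico_subset_Icc_self hs)).1)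
    rw [hY0 q hq] at h1
    refine le_trans (le_of_eq ?_) (h1.trans hεη')
    congr 1
    simp only [one_smul, zero_smul, sub_zero]
    abel
  · intro q q' hq hq'
    set d : ℝ → E := fun s => (Y q s - s • b q.2) - (Y q' s - s • b q'.2) with hd
    have hd' : ∀ s ∈ Icc (0 : ℝ) 1, HasDerivWithinAt d
        (ε • g (ε, (Y q s, q.2)) - ε • g (ε, (Y q' s, q'.2))) (Icc 0 1) s :=
      fun s hs => (hder q hq s hs).sub (hder q' hq' s hs)
    have hd0 : d 0 = q.1 - q'.1 := by simp [hd, hY0 q hq, hY0 q' hq']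
    have hcont : ContinuousOn (fun s => ‖d s - d 0‖) (Icc 0 1) :=
      (ContinuousOn.sub (fun s hs => (hd' s hs).continuousWithinAt) continuousOn_const).norm
    -- Instead of Grönwall's inequality: the maximal deviation `m` satisfies `m ≤ ε K (m + (β + 2)
    -- ‖q - q'‖)`, and `ε K ≤ 1/2`.
    obtain ⟨s₀, hs₀, hmax⟩ := isCompact_Icc.exists_isMaxOn (nonempty_Icc.2 zero_le_one) hcont
    set m := ‖d s₀ - d 0‖
    have hle : ∀ s ∈ Icc (0 : ℝ) 1, ‖d s - d 0‖ ≤ m := fun s hs => hmax hs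
    have hfst : ‖q.1 - q'.1‖ ≤ ‖q - q'‖ := norm_fst_le (q - q')
    have hsnd : ‖q.2 - q'.2‖ ≤ ‖q - q'‖ := norm_snd_le (q - q')
    have hbb : ‖b q.2 - b q'.2‖ ≤ β * ‖q - q'‖ := by
      refine (hβl _ (by simpa using (norm_snd_le q).trans hq) _
        (by simpa using (norm_snd_le q').trans hq')).trans ?_
      gcongr
    have hbound : ∀ s ∈ Ico (0 : ℝ) 1,
        ‖ε • g (ε, (Y q s, q.2)) - ε • g (ε, (Y q' s, q'.2))‖
          ≤ ε * K * (m + (β + 2) * ‖q - q'‖) := by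
      intro s hs
      have hs' := Ico_subset_Icc_self hs
      rw [← smul_sub, norm_smul, Real.norm_of_nonneg hεpos.le, mul_assoc]
      gcongr
      refine (hKl _ (hmem q hq _ (hY q hq s hs').1) _ (hmem q' hq' _ (hY q' hq' s hs').1)).trans ?_
      gcongr
      have h1 : Y q s - Y q' s = (d s - d 0) + (q.1 - q'.1) + s • (b q.2 - b q'.2) := by
        rw [hd0]
        simp only [hd, smul_sub]
        abel
      have h2 : ‖Y q s - Y q' s‖ ≤ m + ‖q - q'‖ + β * ‖q - q'‖ := by
        rw [h1]
        refine (norm_add₃_le).trans ?_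
        have h3 : ‖s • (b q.2 - b q'.2)‖ ≤ 1 * (β * ‖q - q'‖) := by
          rw [norm_smul, Real.norm_of_nonneg hs.1]
          gcongr
          exact hs.2.le
        have := hle s hs'
        linarith
      have hm0 : 0 ≤ m := norm_nonneg _
      have hq0 : 0 ≤ ‖q - q'‖ := norm_nonneg _
      have hbq : 0 ≤ β * ‖q - q'‖ := by positivity
      simp only [Prod.mk_sub_mk, sub_self, norm_prod_le_iff, norm_zero]
      refine ⟨?_, ?_, ?_⟩ <;> nlinarith
    have hmle := norm_image_sub_le_of_norm_deriv_le_segment' hd' hbound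
    have h0 : 0 ≤ ε * K * (m + (β + 2) * ‖q - q'‖) := by positivity
    have hm1 : m ≤ ε * K * (m + (β + 2) * ‖q - q'‖) := by
      have := hmle s₀ hs₀
      rw [sub_zero] at this
      exact this.trans (mul_le_of_le_one_right h0 hs₀.2)
    have hm2 : m ≤ 2 * (ε * K) * ((β + 2) * ‖q - q'‖) := by
      have : ε * K * m ≤ 1 / 2 * m := by gcongr
      nlinarith
    have h1 : (Y q 1 - q.1 - b q.2) - (Y q' 1 - q'.1 - b q'.2) = d 1 - d 0 := by
      rw [hd0]
      simp only [hd, one_smul]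
      abel
    rw [h1]
    refine (hle 1 (by simp)).trans (hm2.trans ?_)
    rw [← mul_assoc]
    gcongr
    nlinarith

end Perturbation

end RigidBody

namespace RigidBody

/-! ### Approximate steering of families of translations -/

section Steering

open Metric Set
open scoped NNReal

variable {E : Type*} [NormedAddCommGroup E]

/-- For `‖(x, p)‖ ≤ L`, the relation `R` steers `x + w₁ p` to `x + w₂ p` up to an error that is
bounded by `η` and `η`-Lipschitz in `(x, p)`. -/
def SteersWithin (R : E → E → Prop) (L η : ℝ) (w₁ w₂ : E → E) : Prop :=
  ∃ e : E × E → E,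
    (∀ q, ‖q‖ ≤ L → R (q.1 + w₁ q.2) (q.1 + w₂ q.2 + e q) ∧ ‖e q‖ ≤ η) ∧
    ∀ q q', ‖q‖ ≤ L → ‖q'‖ ≤ L → ‖e q - e q'‖ ≤ η * ‖q - q'‖

/-- `R` steers the family of translations by `w₁` to the family of translations by `w₂` up to
arbitrarily small Lipschitz errors on bounded sets. -/
def Steers (R : E → E → Prop) (w₁ w₂ : E → E) : Prop :=
  ∀ L η : ℝ, 0 < η → SteersWithin R L η w₁ w₂

/-- Since `w₂` depends only on the parameter, the first error can be moved into the base point: the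
second motion starts from the pair `(q.1 + e₁ q, q.2)`, whence the enlarged radius `L + η`. -/
theorem SteersWithin.trans {R : E → E → Prop} (hR : ∀ x y z, R x y → R y z → R x z)
    {L η η' : ℝ} {w₁ w₂ w₃ : E → E} (hη' : 0 ≤ η') (h₁ : SteersWithin R L η w₁ w₂)
    (h₂ : SteersWithin R (L + η) η' w₂ w₃) :
    SteersWithin R L (η + η' * (1 + η)) w₁ w₃ := by
  obtain ⟨e₁, he₁, hl₁⟩ := h₁
  obtain ⟨e₂, he₂, hl₂⟩ := h₂
  have hmem : ∀ q : E × E, ‖q‖ ≤ L → ‖(q.1 + e₁ q, q.2)‖ ≤ L + η := by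
    intro q hq
    have h1 := (he₁ q hq).2
    have h0 := norm_nonneg (e₁ q)
    rw [norm_prod_le_iff]
    exact ⟨(norm_add_le _ _).trans (by linarith [norm_fst_le q]),
      by linarith [(norm_snd_le q).trans hq]⟩
  refine ⟨fun q => e₁ q + e₂ (q.1 + e₁ q, q.2), fun q hq => ⟨?_, ?_⟩, fun q q' hq hq' => ?_⟩
  · have h1 := (he₁ q hq).1
    have h2 := (he₂ _ (hmem q hq)).1
    simp only at h2
    rw [show q.1 + e₁ q + w₂ q.2 = q.1 + w₂ q.2 + e₁ q by abel] at h2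
    convert hR _ _ _ h1 h2 using 1
    module
  · have h1 := (he₁ q hq).2
    have h2 := (he₂ _ (hmem q hq)).2
    have h0 := (norm_nonneg _).trans h1
    refine (norm_add_le _ _).trans ?_
    nlinarith
  · have h1 := hl₁ q q' hq hq'
    have h2 := hl₂ _ _ (hmem q hq) (hmem q' hq')
    have h0 : 0 ≤ η := (norm_nonneg _).trans (he₁ q hq).2
    have h3 : ‖(q.1 + e₁ q, q.2) - (q'.1 + e₁ q', q'.2)‖ ≤ (1 + η) * ‖q - q'‖ := by
      have hf : ‖q.1 - q'.1‖ ≤ ‖q - q'‖ := norm_fst_le (q - q')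
      have hs : ‖q.2 - q'.2‖ ≤ ‖q - q'‖ := norm_snd_le (q - q')
      have hn := mul_nonneg h0 (norm_nonneg (q - q'))
      rw [norm_prod_le_iff]
      refine ⟨?_, ?_⟩
      · have : (q.1 + e₁ q) - (q'.1 + e₁ q') = (q.1 - q'.1) + (e₁ q - e₁ q') := by abel
        simp only [Prod.mk_sub_mk, this]
        refine (norm_add_le _ _).trans ?_
        linarith
      · simp only [Prod.mk_sub_mk]
        linarith
    have h4 : (e₁ q + e₂ (q.1 + e₁ q, q.2)) - (e₁ q' + e₂ (q'.1 + e₁ q', q'.2))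
        = (e₁ q - e₁ q') + (e₂ (q.1 + e₁ q, q.2) - e₂ (q'.1 + e₁ q', q'.2)) := by abel
    simp only [h4]
    refine (norm_add_le _ _).trans ?_
    have h5 := h2.trans (mul_le_mul_of_nonneg_left h3 hη')
    linarith

theorem SteersWithin.mono {R : E → E → Prop} {L η η' : ℝ} {w₁ w₂ : E → E} (hη : η ≤ η')
    (h : SteersWithin R L η w₁ w₂) : SteersWithin R L η' w₁ w₂ := by
  obtain ⟨e, he, hl⟩ := h
  exact ⟨e, fun q hq => ⟨(he q hq).1, (he q hq).2.trans hη⟩,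
    fun q q' hq hq' => (hl q q' hq hq').trans (by gcongr)⟩

theorem Steers.refl {R : E → E → Prop} (hR : ∀ x, R x x) (w : E → E) : Steers R w w :=
  fun _ η hη => ⟨fun _ => 0, fun q _ => ⟨by simpa using hR _, by simpa using hη.le⟩,
    fun q q' _ _ => by simpa using mul_nonneg hη.le (norm_nonneg _)⟩

theorem Steers.trans {R : E → E → Prop} (hR : ∀ x y z, R x y → R y z → R x z)
    {w₁ w₂ w₃ : E → E} (h₁ : Steers R w₁ w₂) (h₂ : Steers R w₂ w₃) : Steers R w₁ w₃ := by
  intro L η hη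
  -- The composite error is `δ + δ (1 + δ) ≤ 3 δ`.
  set δ := min 1 (η / 3)
  have hδ : 0 < δ := by positivity
  have hδ1 : δ ≤ 1 := min_le_left _ _
  have hδ3 : δ ≤ η / 3 := min_le_right _ _
  exact (SteersWithin.trans hR hδ.le (h₁ L δ hδ) (h₂ (L + δ) δ hδ)).mono (by nlinarith)

/-- A relation that steers the zero family to the identity family relates any two points. -/
theorem Steers.rel_of_id [CompleteSpace E] {R : E → E → Prop} (h : Steers R (fun _ => 0) id)
    (x y : E) : R x y := by
  set L : ℝ := ‖x‖ + ‖y‖ + 1 with hL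
  have hx := norm_nonneg x
  have hy := norm_nonneg y
  obtain ⟨e, he, hl⟩ := h L (1 / 2) (by norm_num)
  have hmem : ∀ p ∈ closedBall (0 : E) L, ‖(x, p)‖ ≤ L := by
    intro p hp
    rw [mem_closedBall_zero_iff] at hp
    rw [norm_prod_le_iff]
    exact ⟨by simp only; linarith, hp⟩
  -- A fixed point `p` satisfies `x + p + e (x, p) = y`, so the motion with parameter `p` ends
  -- exactly at `y`.
  have hmaps : MapsTo (fun p => y - x - e (x, p)) (closedBall (0 : E) L) (closedBall (0 : E) L) := by
    intro p hp
    rw [mem_closedBall_zero_iff]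
    have h1 := (he _ (hmem p hp)).2
    refine (norm_sub_le _ _).trans ?_
    have h2 := norm_sub_le y x
    linarith
  have hc : ContractingWith (1 / 2) (hmaps.restrict (fun p => y - x - e (x, p)) _ _) := by
    refine ⟨by rw [← NNReal.coe_lt_coe]; norm_num, LipschitzWith.of_dist_le_mul fun p p' => ?_⟩
    have h1 := hl _ _ (hmem p.1 p.2) (hmem p'.1 p'.2)
    rw [Subtype.dist_eq, Subtype.dist_eq, dist_eq_norm, dist_eq_norm]
    simp only [MapsTo.val_restrict_apply, sub_sub_sub_cancel_left]
    rw [norm_sub_rev]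
    refine h1.trans (le_of_eq ?_)
    simp [Prod.norm_def]
  obtain ⟨p, hp, hfix, -⟩ := hc.exists_fixedPoint' isClosed_closedBall.isComplete hmaps
    (x := 0) (by rw [mem_closedBall_zero_iff, norm_zero]; positivity) (edist_ne_top _ _)
  have h1 := (he _ (hmem p hp)).1
  have h2 : y - x - e (x, p) = p := hfix
  simp only [id, add_zero] at h1
  rwa [show x + p + e (x, p) = y by nth_rw 1 [← h2]; abel] at h1

variable [NormedSpace ℝ E]

/-- The relation `R` is reflexive, transitive and contains all pairs of points that are joined by a
solution of `x' = B(x, x) - ν x + v` with a constant control `v ∈ V`. -/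
structure IsReachability (B : E →L[ℝ] E →L[ℝ] E) (ν : ℝ) (V : Submodule ℝ E)
    (R : E → E → Prop) : Prop where
  refl : ∀ x, R x x
  trans : ∀ x y z, R x y → R y z → R x z
  of_hasDerivWithinAt : ∀ v ∈ V, ∀ T : ℝ, 0 < T → ∀ x : ℝ → E,
    (∀ s ∈ Icc 0 T, HasDerivWithinAt x (B (x s) (x s) - ν • x s + v) (Icc 0 T) s) → R (x 0) (x T)

variable {B : E →L[ℝ] E →L[ℝ] E} {ν : ℝ} {V : Submodule ℝ E} {R : E → E → Prop}

/-- If, after the time change `τ ε` and the translation by `w ε`, the controlled vector field is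
`b + ε g`, then the flow steers `w ε` to `w ε + b` for small `ε`. -/
theorem IsReachability.exists_steersWithin [FiniteDimensional ℝ E] (hR : IsReachability B ν V R)
    {b : E → E} (hb : ContDiff ℝ 1 b) {g : ℝ × (E × E) → E} (hg : ContDiff ℝ 1 g)
    {w u : ℝ → E → E} {τ : ℝ → ℝ} (hτ : ∀ ε, 0 < ε → 0 < τ ε)
    (hu : ∀ ε, 0 < ε → ∀ p, u ε p ∈ V)
    (h : ∀ ε, 0 < ε → ∀ p y, τ ε • (B (y + w ε p) (y + w ε p) - ν • (y + w ε p) + u ε p) =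
      b p + ε • g (ε, (y, p)))
    (L : ℝ) {η : ℝ} (hη : 0 < η) :
    ∃ ε, 0 < ε ∧ SteersWithin R L η (w ε) (fun p => w ε p + b p) := by
  obtain ⟨ε, hε, Y, hY, hl⟩ := exists_perturbed_translation hb hg L hη
  refine ⟨ε, hε, fun q => Y q 1 - q.1 - b q.2, fun q hq => ⟨?_, (hY q hq).2.2⟩, hl⟩
  have hT := hτ ε hε
  have key := hR.of_hasDerivWithinAt (u ε q.2) (hu ε hε q.2) (τ ε) hT
    (fun s => Y q ((τ ε)⁻¹ * s) + w ε q.2) fun s hs => by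
      have hmaps : MapsTo (fun s => (τ ε)⁻¹ * s) (Icc 0 (τ ε)) (Icc 0 1) := by
        intro s hs
        refine ⟨mul_nonneg (inv_nonneg.2 hT.le) hs.1, ?_⟩
        rw [inv_mul_le_iff₀ hT, mul_one]
        exact hs.2
      have h1 := (hY q hq).2.1 _ (hmaps hs)
      rw [← h ε hε] at h1
      have h2 : HasDerivWithinAt (fun s : ℝ => (τ ε)⁻¹ * s) ((τ ε)⁻¹ * 1) (Icc 0 (τ ε)) s :=
        ((hasDerivAt_id s).const_mul _).hasDerivWithinAt
      have h3 := (h1.scomp s h2 hmaps).add_const (w ε q.2)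
      rwa [smul_smul, mul_one, inv_mul_cancel₀ hT.ne', one_smul] at h3
  simp only [mul_zero, inv_mul_cancel₀ hT.ne', (hY q hq).1] at key
  convert key using 1
  simp only
  module

/-- The directions along which `R` realises all smooth families of translations, up to arbitrarily
small errors. -/
def IsReachability.steerable (hR : IsReachability B ν V R) : Submodule ℝ E where
  -- The arbitrary offset `c` lets motions be concatenated; the arbitrary coefficient `a` gives
  -- closure under scalars and later admits coordinate functions.
  carrier := {v | ∀ a : E → ℝ, ContDiff ℝ 1 a → ∀ c : E → E, ContDiff ℝ 1 c →
    Steers R c (fun p => c p + a p • v)}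
  zero_mem' := fun a _ c _ => by simpa using Steers.refl hR.refl c
  add_mem' := fun {v v'} hv hv' a ha c hc => by
    have h1 := hv' a ha (fun p => c p + a p • v) (by fun_prop)
    simp only [add_assoc, ← smul_add] at h1
    exact (hv a ha c hc).trans hR.trans h1
  smul_mem' := fun r v hv a ha c hc => by
    have h1 := hv (fun p => a p * r) (by fun_prop) c hc
    simpa only [mul_smul] using h1

/-- The control `ε⁻¹ a(p) v` applied for time `ε` acts as an impulse: it moves the state by `a(p)
v`, while the drift contributes only `O(ε)`. -/
theorem IsReachability.le_steerable [FiniteDimensional ℝ E] (hR : IsReachability B ν V R) :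
    V ≤ hR.steerable := by
  intro v hv a ha c hc L η hη
  obtain ⟨ε, -, h⟩ := hR.exists_steersWithin (b := fun p => a p • v)
    (g := fun z => B (z.2.1 + c z.2.2) (z.2.1 + c z.2.2) - ν • (z.2.1 + c z.2.2))
    (w := fun _ => c) (u := fun ε p => (ε⁻¹ * a p) • v) (τ := fun ε => ε)
    (by fun_prop) (by fun_prop) (fun _ h => h) (fun _ _ p => V.smul_mem _ hv)
    (fun ε hε p y => by
      rw [smul_add, smul_smul, ← mul_assoc, mul_inv_cancel₀ hε.ne', one_mul, add_comm]) L hη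
  exact h

/-- Steering along an equilibrium direction `v` and along `w` yields steering along `B(v, w)`. -/
theorem IsReachability.bilin_mem_steerable [FiniteDimensional ℝ E] (hR : IsReachability B ν V R)
    (hB : ∀ x y, B x y = B y x) {v w : E} (hv : v ∈ hR.steerable) (hw : w ∈ hR.steerable)
    (hvv : B v v = 0) : B v w ∈ hR.steerable := by
  intro a ha c hc L η hη
  set b : E → E := fun p => a p • B v w with hb
  -- Over time `ε³`, the displacement turns `2 B(ε⁻² v, ε⁻¹ (a/2) w)` into `a B(v, w)`; `B(v, v) =
  -- 0` removes the only divergent term. The radius is `L + 1` because the initial displacement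
  -- depends on `ε`, so its error, at most `1`, must be allowed for before `ε` is known.
  obtain ⟨ε, hε, h⟩ := hR.exists_steersWithin (b := b)
    (g := fun z => z.1 ^ 2 • B (z.2.1 + c z.2.2) (z.2.1 + c z.2.2) +
      (2 : ℝ) • B (z.2.1 + c z.2.2) v + (z.1 * a z.2.2) • B (z.2.1 + c z.2.2) w +
      (a z.2.2 ^ 2 / 4) • B w w -
      ν • (z.1 ^ 2 • (z.2.1 + c z.2.2) + v + (z.1 * a z.2.2 / 2) • w))
    (w := fun ε p => c p + ε⁻¹ ^ 2 • v + (ε⁻¹ * a p / 2) • w) (u := fun _ _ => 0)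
    (τ := fun ε => ε ^ 3) (by fun_prop) (by fun_prop) (fun _ h => by positivity)
    (fun _ _ p => V.zero_mem)
    (fun ε hε p y => by
      have h1 : B v (y + c p) = B (y + c p) v := hB _ _
      have h2 : B w (y + c p) = B (y + c p) w := hB _ _
      have h3 : B w v = B v w := hB _ _
      simp only [← add_assoc]
      generalize y + c p = z at *
      simp only [map_add, map_smul, add_apply, smul_apply,
        h1, h2, h3, hvv, hb]
      match_scalars <;> field_simp <;> ring) (L + 1) (η := min 1 (η / 20)) (by positivity)
  set δ := min 1 (η / 20)
  have hδ : 0 < δ := by positivity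
  have hδ1 : δ ≤ 1 := min_le_left _ _
  have hδ3 : δ ≤ η / 20 := min_le_right _ _
  set W : E → E := fun p => c p + ε⁻¹ ^ 2 • v + (ε⁻¹ * a p / 2) • w with hW
  have s1 : Steers R c W :=
    (hv (fun _ => ε⁻¹ ^ 2) contDiff_const c hc).trans hR.trans
      (hw (fun p => ε⁻¹ * a p / 2) (by fun_prop) (fun p => c p + ε⁻¹ ^ 2 • v) (by fun_prop))
  -- The displacement is undone by steering with the opposite coefficients.
  have s2 : Steers R (fun p => W p + b p) (fun p => c p + b p) := by
    have t1 := hw (fun p => -(ε⁻¹ * a p / 2)) (by fun_prop) (fun p => W p + b p) (by fun_prop)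
    have t2 := hv (fun _ => -ε⁻¹ ^ 2) contDiff_const
      (fun p => W p + b p + (-(ε⁻¹ * a p / 2)) • w) (by fun_prop)
    have t3 : (fun p => W p + b p + (-(ε⁻¹ * a p / 2)) • w + -ε⁻¹ ^ 2 • v)
        = fun p => c p + b p := by
      funext p
      simp only [hW, neg_smul]
      abel
    rw [t3] at t2
    exact t1.trans hR.trans t2
  have r1 : SteersWithin R L (δ + δ * (1 + δ)) c (fun p => W p + b p) := by
    refine SteersWithin.trans hR.trans hδ.le (s1 L δ hδ) ?_
    obtain ⟨e, he, hl⟩ := h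
    exact ⟨e, fun q hq => he q (by linarith), fun q q' hq hq' => hl q q' (by linarith) (by linarith)⟩
  refine (SteersWithin.trans hR.trans hδ.le r1 (s2 _ δ hδ)).mono ?_
  have hδ2 : δ * δ ≤ δ := mul_le_of_le_one_right hδ.le hδ1
  nlinarith

/-- If all directions are steerable then any two points are related. -/
theorem IsReachability.rel_of_steerable_eq_top [FiniteDimensional ℝ E]
    (hR : IsReachability B ν V R) (h : hR.steerable = ⊤) (x y : E) : R x y := by
  have : CompleteSpace E := FiniteDimensional.complete ℝ E
  let β := Module.finBasis ℝ E
  refine Steers.rel_of_id ?_ x y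
  have key : ∀ s : Finset (Fin (Module.finrank ℝ E)),
      Steers R (fun _ => 0) (fun p => ∑ i ∈ s, β.coord i p • β i) := by
    intro s
    induction s using Finset.induction_on with
    | empty => simpa using Steers.refl hR.refl (fun _ => (0 : E))
    | insert i s hi ih =>
      have hcoord : ∀ i, ContDiff ℝ 1 (fun p => β.coord i p) := fun i =>
        (LinearMap.toContinuousLinearMap (β.coord i)).contDiff
      have hmem : β i ∈ hR.steerable := h ▸ Submodule.mem_top
      have h1 := hmem (fun p => β.coord i p) (hcoord i) (fun p => ∑ i ∈ s, β.coord i p • β i)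
        (by fun_prop)
      have h2 := ih.trans hR.trans h1
      simp only [Finset.sum_insert hi]
      simpa only [add_comm] using h2
  convert key Finset.univ using 1
  funext p
  simp [β.sum_repr]

end Steering

end RigidBody

namespace RigidBody

/-! ### Trajectories of the Euler–Frahm system and their concatenation -/

section Reachability

attribute [local instance] Matrix.normedAddCommGroup Matrix.normedSpace

open MeasureTheory Set

variable {n : ℕ} {C : Matrix (Fin n) (Fin n) ℝ}

/-- The polarization of `Ω ↦ [C, Ω²]`. -/
noncomputable def commSymmMul (hC : C.PosDef) : so n →ₗ[ℝ] so n →ₗ[ℝ] so n :=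
  LinearMap.mk₂ ℝ (fun X Y => ⟨(2⁻¹ : ℝ) • ⁅C, X.1 * Y.1 + Y.1 * X.1⁆, by
      have hX := (mem_so_iff _).1 X.2
      have hY := (mem_so_iff _).1 Y.2
      rw [mem_so_iff, Ring.lie_def, Matrix.transpose_smul, Matrix.transpose_sub,
        Matrix.transpose_mul, Matrix.transpose_mul, Matrix.transpose_add, Matrix.transpose_mul,
        Matrix.transpose_mul, hX, hY, transpose_eq_of_posDef hC, ← smul_neg]
      congr 1
      noncomm_ring⟩)
    (fun X X' Y => by
      ext1
      simp only [Ring.lie_def, Submodule.coe_add, ← smul_add]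
      congr 1
      noncomm_ring)
    (fun c X Y => by
      ext1
      simp only [Ring.lie_def, Submodule.coe_smul, Matrix.smul_mul, Matrix.mul_smul, ← smul_add,
        ← smul_sub]
      rw [smul_comm])
    (fun X Y Y' => by
      ext1
      simp only [Ring.lie_def, Submodule.coe_add, ← smul_add]
      congr 1
      noncomm_ring)
    (fun c X Y => by
      ext1
      simp only [Ring.lie_def, Submodule.coe_smul, Matrix.smul_mul, Matrix.mul_smul, ← smul_add,
        ← smul_sub]
      rw [smul_comm])

theorem coe_commSymmMul (hC : C.PosDef) (X Y : so n) :
    (commSymmMul hC X Y : Matrix (Fin n) (Fin n) ℝ) =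
      (2⁻¹ : ℝ) • ⁅C, X.1 * Y.1 + Y.1 * X.1⁆ := rfl

theorem commSymmMul_self (hC : C.PosDef) (X : so n) : commSymmMul hC X X = commSq hC X := by
  ext1
  change (2⁻¹ : ℝ) • ⁅C, X.1 * X.1 + X.1 * X.1⁆ = ⁅C, X.1 ^ 2⁆
  rw [← sq, ← two_smul ℝ, Ring.lie_def, Ring.lie_def, Matrix.mul_smul,
    Matrix.smul_mul, ← smul_sub, smul_smul, inv_mul_cancel₀ two_ne_zero, one_smul]

/-- The symmetric bilinear map whose diagonal is the Euler field `Ω ↦ I_C⁻¹ [C, Ω²]`. -/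
noncomputable def eulerBilin (hC : C.PosDef) : so n →L[ℝ] so n →L[ℝ] so n :=
  ((commSymmMul hC).compr₂ (inertiaEquiv hC).symm.toLinearMap).toContinuousBilinearMap

theorem eulerBilin_apply (hC : C.PosDef) (X Y : so n) :
    eulerBilin hC X Y = (inertiaEquiv hC).symm (commSymmMul hC X Y) := rfl

theorem eulerBilin_comm (hC : C.PosDef) (X Y : so n) :
    eulerBilin hC X Y = eulerBilin hC Y X := by
  rw [eulerBilin_apply, eulerBilin_apply]
  congr 1
  ext1
  rw [coe_commSymmMul, coe_commSymmMul, add_comm]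

theorem eulerFrahm_eq (hC : C.PosDef) (ν : ℝ) {r : ℕ} (G : Fin r → so n) (X : so n)
    (v : Fin r → ℝ) :
    eulerFrahm hC ν G X v = eulerBilin hC X X - ν • X + ∑ i, v i • G i := by
  rw [eulerFrahm, eulerBilin_apply, commSymmMul_self]

/-- The matrix entry `(j, k)` as a continuous linear functional on `so n`. -/
noncomputable def entry (j k : Fin n) : so n →L[ℝ] ℝ :=
  LinearMap.toContinuousLinearMap (Matrix.entryLinearMap ℝ ℝ j k ∘ₗ (so n).subtype)

theorem entry_apply (j k : Fin n) (X : so n) :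
    entry j k X = (X : Matrix (Fin n) (Fin n) ℝ) j k := rfl

/-- A trajectory of the Euler–Frahm system joins `X` to `Y`. -/
def Reachable (hC : C.PosDef) (ν : ℝ) {r : ℕ} (G : Fin r → so n) (X Y : so n) : Prop :=
  ∃ T : ℝ, 0 ≤ T ∧ ∃ (u : ℝ → Fin r → ℝ) (Ω : ℝ → so n),
    IsTrajectory hC ν G T u Ω ∧ Ω 0 = X ∧ Ω T = Y

variable {hC : C.PosDef} {ν T : ℝ} {r : ℕ} {G : Fin r → so n} {u : ℝ → Fin r → ℝ} {Ω : ℝ → so n}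

theorem IsTrajectory.intervalIntegrable (h : IsTrajectory hC ν G T u Ω) (hT : 0 ≤ T) (j k : Fin n) :
    IntervalIntegrable
      (fun s => (eulerFrahm hC ν G (Ω s) (u s) : Matrix (Fin n) (Fin n) ℝ) j k) volume 0 T := by
  obtain ⟨b, hb⟩ := h.bounded_control
  have h1 : IntervalIntegrable
      (fun s => entry j k (eulerBilin hC (Ω s) (Ω s) - ν • Ω s)) volume 0 T := by
    apply ContinuousOn.intervalIntegrable
    rw [uIcc_of_le hT]
    have := h.continuousOn
    fun_prop
  have h2 : ∀ i, IntervalIntegrable (fun s => u s i * entry j k (G i)) volume 0 T := by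
    intro i
    refine IntervalIntegrable.mul_const ?_ _
    rw [intervalIntegrable_iff_integrableOn_Icc_of_le hT]
    refine Measure.integrableOn_of_bounded (M := b) measure_Icc_lt_top.ne
      ((measurable_pi_apply i).comp h.measurable_control).aestronglyMeasurable ?_
    filter_upwards [ae_restrict_mem measurableSet_Icc] with s hs
    exact hb s hs i
  refine (h1.add (IntervalIntegrable.sum Finset.univ fun i _ => h2 i)).congr ?_
  intro s _
  simp only [← entry_apply, eulerFrahm_eq, map_add, map_sum, map_smul, smul_eq_mul,
    Finset.sum_apply]

/-- Concatenation of trajectories. -/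
theorem Reachable.trans {X Y Z : so n} (h₁ : Reachable hC ν G X Y) (h₂ : Reachable hC ν G Y Z) :
    Reachable hC ν G X Z := by
  obtain ⟨T₁, hT₁, u₁, Ω₁, h₁, rfl, rfl⟩ := h₁
  obtain ⟨T₂, hT₂, u₂, Ω₂, h₂, h0, rfl⟩ := h₂
  set u : ℝ → Fin r → ℝ := fun t => if t ≤ T₁ then u₁ t else u₂ (t - T₁) with hu
  set Ω : ℝ → so n := fun t => if t ≤ T₁ then Ω₁ t else Ω₂ (t - T₁) with hΩ
  have hΩl : ∀ t, t ≤ T₁ → Ω t = Ω₁ t := fun t ht => by simp only [hΩ, if_pos ht]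
  have hul : ∀ t, t ≤ T₁ → u t = u₁ t := fun t ht => by simp only [hu, if_pos ht]
  have hΩr : ∀ t, T₁ ≤ t → Ω t = Ω₂ (t - T₁) := by
    intro t ht
    rcases ht.eq_or_lt with rfl | ht
    · rw [hΩl _ le_rfl, sub_self, h0]
    · simp only [hΩ, if_neg ht.not_ge]
  have hur : ∀ t, T₁ < t → u t = u₂ (t - T₁) := fun t ht => by simp only [hu, if_neg ht.not_ge]
  have hshift : ∀ t ∈ Icc T₁ (T₁ + T₂), t - T₁ ∈ Icc 0 T₂ := fun t ht =>
    ⟨by linarith [ht.1], by linarith [ht.2]⟩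
  have hintl : ∀ t ∈ Icc 0 T₁, ∀ j k,
      ∫ s in (0 : ℝ)..t, (eulerFrahm hC ν G (Ω s) (u s) : Matrix (Fin n) (Fin n) ℝ) j k =
      ∫ s in (0 : ℝ)..t, (eulerFrahm hC ν G (Ω₁ s) (u₁ s) : Matrix (Fin n) (Fin n) ℝ) j k := by
    intro t ht j k
    refine intervalIntegral.integral_congr fun s hs => ?_
    rw [uIcc_of_le ht.1] at hs
    simp only [hΩl s (hs.2.trans ht.2), hul s (hs.2.trans ht.2)]
  refine ⟨T₁ + T₂, by positivity, u, Ω, ⟨?_, ?_, ?_, ?_⟩, hΩl 0 hT₁, ?_⟩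
  · exact Measurable.ite measurableSet_Iic h₁.measurable_control
      (h₂.measurable_control.comp (measurable_id.sub_const T₁))
  · obtain ⟨b₁, hb₁⟩ := h₁.bounded_control
    obtain ⟨b₂, hb₂⟩ := h₂.bounded_control
    refine ⟨max b₁ b₂, fun t ht i => ?_⟩
    rcases le_or_gt t T₁ with hle | hlt
    · rw [hul t hle]
      exact (hb₁ t ⟨ht.1, hle⟩ i).trans (le_max_left _ _)
    · rw [hur t hlt]
      exact (hb₂ _ (hshift t ⟨hlt.le, ht.2⟩) i).trans (le_max_right _ _)
  · rw [← Icc_union_Icc_eq_Icc hT₁ (by linarith : T₁ ≤ T₁ + T₂)]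
    refine ContinuousOn.union_of_isClosed ?_ ?_ isClosed_Icc isClosed_Icc
    · exact h₁.continuousOn.congr fun t ht => hΩl t ht.2
    · exact (h₂.continuousOn.comp (by fun_prop) hshift).congr fun t ht => hΩr t ht.1
  · intro t ht j k
    rw [hΩl 0 hT₁]
    rcases le_total t T₁ with hle | hle
    · rw [hΩl t hle, hintl t ⟨ht.1, hle⟩]
      exact h₁.integral_eq t ⟨ht.1, hle⟩ j k
    · have hmem := hshift t ⟨hle, ht.2⟩
      -- The half-open interval matters: at `T₁` the concatenated control still takes the value of
      -- `u₁`, which the integral does not see.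
      have e2 : EqOn
          (fun s => (eulerFrahm hC ν G (Ω₂ (s - T₁)) (u₂ (s - T₁)) :
            Matrix (Fin n) (Fin n) ℝ) j k)
          (fun s => (eulerFrahm hC ν G (Ω s) (u s) : Matrix (Fin n) (Fin n) ℝ) j k)
          (Ioc T₁ t) := fun s hs => by simp only [hΩr s hs.1.le, hur s hs.1]
      have i1 : IntervalIntegrable (fun s => (eulerFrahm hC ν G (Ω s) (u s) :
          Matrix (Fin n) (Fin n) ℝ) j k) volume 0 T₁ := by
        refine (h₁.intervalIntegrable hT₁ j k).congr_ae ?_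
        filter_upwards [ae_restrict_mem measurableSet_uIoc] with s hs
        rw [uIoc_of_le hT₁] at hs
        simp only [hΩl s hs.2, hul s hs.2]
      have i2 : IntervalIntegrable (fun s => (eulerFrahm hC ν G (Ω s) (u s) :
          Matrix (Fin n) (Fin n) ℝ) j k) volume T₁ t := by
        have h3 := ((h₂.intervalIntegrable hT₂ j k).mono_set (c := 0) (d := t - T₁) (by
          rw [uIcc_of_le hT₂, uIcc_of_le hmem.1]
          exact Icc_subset_Icc_right hmem.2)).comp_sub_right T₁
        rw [zero_add, sub_add_cancel] at h3
        refine h3.congr_ae ?_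
        filter_upwards [ae_restrict_mem measurableSet_uIoc] with s hs
        rw [uIoc_of_le hle] at hs
        exact e2 hs
      have e3 : ∫ s in T₁..t, (eulerFrahm hC ν G (Ω s) (u s) : Matrix (Fin n) (Fin n) ℝ) j k =
          ∫ s in (0 : ℝ)..(t - T₁), (eulerFrahm hC ν G (Ω₂ s) (u₂ s) :
            Matrix (Fin n) (Fin n) ℝ) j k := by
        rw [← sub_self T₁, ← intervalIntegral.integral_comp_sub_right
          (fun s => (eulerFrahm hC ν G (Ω₂ s) (u₂ s) : Matrix (Fin n) (Fin n) ℝ) j k)]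
        refine intervalIntegral.integral_congr_ae (Filter.Eventually.of_forall fun s hs => ?_)
        rw [uIoc_of_le hle] at hs
        exact (e2 hs).symm
      rw [← intervalIntegral.integral_add_adjacent_intervals i1 i2, e3,
        hintl T₁ ⟨hT₁, le_rfl⟩, ← add_assoc, ← h₁.integral_eq T₁ ⟨hT₁, le_rfl⟩, hΩr t hle,
        h₂.integral_eq _ hmem, h0]
  · rw [hΩr _ (by linarith), add_sub_cancel_left]

theorem Reachable.refl (X : so n) : Reachable hC ν G X X :=
  ⟨0, le_rfl, fun _ => 0, fun _ => X,
    { measurable_control := measurable_const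
      bounded_control := ⟨0, by simp⟩
      continuousOn := continuousOn_const
      integral_eq := fun t ht j k => by
        rw [Icc_self, mem_singleton_iff] at ht
        simp [ht] }, rfl, rfl⟩

theorem Reachable.of_hasDerivWithinAt {v : so n} (hv : v ∈ Submodule.span ℝ (range G)) {T : ℝ}
    (hT : 0 ≤ T) {x : ℝ → so n}
    (hx : ∀ s ∈ Icc 0 T,
      HasDerivWithinAt x (eulerBilin hC (x s) (x s) - ν • x s + v) (Icc 0 T) s) :
    Reachable hC ν G (x 0) (x T) := by
  obtain ⟨c, rfl⟩ := (Submodule.mem_span_range_iff_exists_fun ℝ).1 hv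
  have hcont : ContinuousOn x (Icc 0 T) := fun s hs => (hx s hs).continuousWithinAt
  refine ⟨T, hT, fun _ => c, x, ⟨measurable_const, ?_, hcont, ?_⟩, rfl, rfl⟩
  · exact ⟨∑ i, |c i|, fun _ _ i =>
      Finset.single_le_sum (f := fun i => |c i|) (fun i _ => abs_nonneg _) (Finset.mem_univ i)⟩
  · intro t ht j k
    have hct : ContinuousOn x (Icc 0 t) := hcont.mono (Icc_subset_Icc_right ht.2)
    simp only [← entry_apply, eulerFrahm_eq]
    rw [intervalIntegral.integral_eq_sub_of_hasDerivAt_of_le (f := fun s => entry j k (x s)) ht.1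
      (by fun_prop)]
    · abel
    · intro s hs
      have hs' : s ∈ Ioo 0 T := ⟨hs.1, hs.2.trans_le ht.2⟩
      exact (entry j k).hasFDerivAt.comp_hasDerivAt s
        ((hx s (Ioo_subset_Icc_self hs')).hasDerivAt (Icc_mem_nhds hs'.1 hs'.2))
    · apply ContinuousOn.intervalIntegrable
      rw [uIcc_of_le ht.1]
      fun_prop

theorem isReachability_reachable (hC : C.PosDef) (ν : ℝ) {r : ℕ} (G : Fin r → so n) :
    IsReachability (eulerBilin hC) ν (Submodule.span ℝ (range G)) (Reachable hC ν G) where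
  refl := Reachable.refl
  trans _ _ _ := Reachable.trans
  of_hasDerivWithinAt _ hv _ hT _ hx := Reachable.of_hasDerivWithinAt hv hT.le hx

/-- If every subspace that contains the torque directions and is stable under bracketing with its
equilibria is everything, the system is globally controllable. -/
theorem globallyControllable_of_forall_submodule (hC : C.PosDef) (ν : ℝ) {r : ℕ} (G : Fin r → so n)
    (h : ∀ S : Submodule ℝ (so n), (∀ i, G i ∈ S) →
      (∀ X ∈ S, ∀ Y ∈ S, eulerBilin hC X X = 0 → eulerBilin hC X Y ∈ S) → S = ⊤) :
    GloballyControllable hC ν G := by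
  have hR := isReachability_reachable hC ν G
  exact hR.rel_of_steerable_eq_top (h hR.steerable
    (fun i => hR.le_steerable (Submodule.subset_span (mem_range_self i)))
    fun X hX Y hY hXX => hR.bilin_mem_steerable (eulerBilin_comm hC) hX hY hXX)

end Reachability

end RigidBody

namespace RigidBody

/-! ### Two torques that generate `so(n)` -/

section Torques

open Finset

variable {n : ℕ} {C : Matrix (Fin n) (Fin n) ℝ}

/-- A submodule stable under an endomorphism contains the components of its elements along
eigenvectors with distinct eigenvalues. -/
theorem mem_of_sum_eigenvectors_mem {ι M : Type*} [DecidableEq ι] [AddCommGroup M] [Module ℝ M]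
    {S : Submodule ℝ M} {f : M →ₗ[ℝ] M} (hf : ∀ x ∈ S, f x ∈ S) {μ : ι → ℝ} (s : Finset ι)
    (hμ : Set.InjOn μ s) (w : ι → M) (hw : ∀ i ∈ s, f (w i) = μ i • w i)
    (hs : ∑ i ∈ s, w i ∈ S) : ∀ i ∈ s, w i ∈ S := by
  induction s using Finset.induction_on generalizing w with
  | empty => simp
  | insert j s hj ih =>
    have key : ∀ i ∈ s, w i ∈ S := by
      intro i hi
      have hne : μ i - μ j ≠ 0 := by
        rw [sub_ne_zero]
        intro h
        have := hμ (mem_coe.2 (mem_insert_of_mem hi)) (mem_coe.2 (mem_insert_self j s)) h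
        exact hj (this ▸ hi)
      -- Applying `f - μ j` to the sum kills `w j` and rescales every other component by a nonzero
      -- factor.
      have h1 := ih (hμ.mono (by simp)) (fun i => (μ i - μ j) • w i) (fun i hi => by
          rw [map_smul, hw i (mem_insert_of_mem hi), smul_comm]) (by
          have h2 := S.sub_mem (hf _ hs) (S.smul_mem (μ j) hs)
          rw [map_sum, smul_sum, ← sum_sub_distrib, sum_insert hj,
            hw j (mem_insert_self j s), sub_self, zero_add] at h2
          convert h2 using 1
          refine sum_congr rfl fun i hi => ?_
          rw [hw i (mem_insert_of_mem hi), sub_smul]) i hi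
      exact (S.smul_mem_iff hne).1 h1
    intro i hi
    rcases mem_insert.1 hi with rfl | hi
    · rw [sum_insert hj] at hs
      exact (S.add_mem_iff_left (S.sum_mem key)).1 hs
    · exact key i hi

/-- The matrix unit `eᵢ eⱼᵀ` in an orthonormal basis of eigenvectors. -/
noncomputable def eigenUnit (hC : C.PosDef) (i j : Fin n) : Matrix (Fin n) (Fin n) ℝ :=
  (hC.isHermitian.eigenvectorUnitary : Matrix (Fin n) (Fin n) ℝ) * Matrix.single i j 1 *
    star (hC.isHermitian.eigenvectorUnitary : Matrix (Fin n) (Fin n) ℝ)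

theorem eq_eigenvectorUnitary_mul (hC : C.PosDef) :
    C = (hC.isHermitian.eigenvectorUnitary : Matrix (Fin n) (Fin n) ℝ) *
      Matrix.diagonal hC.isHermitian.eigenvalues *
      star (hC.isHermitian.eigenvectorUnitary : Matrix (Fin n) (Fin n) ℝ) := by
  conv_lhs => rw [hC.isHermitian.spectral_theorem, Unitary.conjStarAlgAut_apply]
  rfl

theorem conj_mul_conj (hC : C.PosDef) (X Y : Matrix (Fin n) (Fin n) ℝ) :
    ((hC.isHermitian.eigenvectorUnitary : Matrix (Fin n) (Fin n) ℝ) * X *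
      star (hC.isHermitian.eigenvectorUnitary : Matrix (Fin n) (Fin n) ℝ)) *
    ((hC.isHermitian.eigenvectorUnitary : Matrix (Fin n) (Fin n) ℝ) * Y *
      star (hC.isHermitian.eigenvectorUnitary : Matrix (Fin n) (Fin n) ℝ)) =
    (hC.isHermitian.eigenvectorUnitary : Matrix (Fin n) (Fin n) ℝ) * (X * Y) *
      star (hC.isHermitian.eigenvectorUnitary : Matrix (Fin n) (Fin n) ℝ) := by
  have h := Unitary.coe_star_mul_self hC.isHermitian.eigenvectorUnitary
  set U := (hC.isHermitian.eigenvectorUnitary : Matrix (Fin n) (Fin n) ℝ)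
  calc U * X * star U * (U * Y * star U) = U * X * (star U * U) * Y * star U := by
        simp only [Matrix.mul_assoc]
    _ = _ := by rw [h, Matrix.mul_one]; simp only [Matrix.mul_assoc]

theorem eigenUnit_mul_same (hC : C.PosDef) (i j k : Fin n) :
    eigenUnit hC i j * eigenUnit hC j k = eigenUnit hC i k := by
  rw [eigenUnit, eigenUnit, conj_mul_conj hC, Matrix.single_mul_single_same, one_mul, eigenUnit]

theorem eigenUnit_mul_of_ne (hC : C.PosDef) (i : Fin n) {j k : Fin n} (h : j ≠ k) (l : Fin n) :
    eigenUnit hC i j * eigenUnit hC k l = 0 := by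
  rw [eigenUnit, eigenUnit, conj_mul_conj hC, Matrix.single_mul_single_of_ne _ _ _ _ h]
  simp

theorem mul_eigenUnit (hC : C.PosDef) (i j : Fin n) :
    C * eigenUnit hC i j = hC.isHermitian.eigenvalues i • eigenUnit hC i j := by
  have h : Matrix.diagonal hC.isHermitian.eigenvalues * Matrix.single i j (1 : ℝ) =
      hC.isHermitian.eigenvalues i • Matrix.single i j 1 := by
    ext a b
    rw [Matrix.diagonal_mul, Matrix.smul_apply, Matrix.single_apply]
    split_ifs with hab
    · rw [hab.1, smul_eq_mul]
    · simp
  refine (congrArg (· * eigenUnit hC i j) (eq_eigenvectorUnitary_mul hC)).trans ?_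
  simp only [eigenUnit, conj_mul_conj hC, h, Matrix.mul_smul, Matrix.smul_mul]

theorem eigenUnit_mul (hC : C.PosDef) (i j : Fin n) :
    eigenUnit hC i j * C = hC.isHermitian.eigenvalues j • eigenUnit hC i j := by
  have h : Matrix.single i j (1 : ℝ) * Matrix.diagonal hC.isHermitian.eigenvalues =
      hC.isHermitian.eigenvalues j • Matrix.single i j 1 := by
    ext a b
    rw [Matrix.mul_diagonal, Matrix.smul_apply, Matrix.single_apply]
    split_ifs with hab
    · rw [hab.2, smul_eq_mul, mul_comm]
    · simp
  refine (congrArg (eigenUnit hC i j * ·) (eq_eigenvectorUnitary_mul hC)).trans ?_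
  simp only [eigenUnit, conj_mul_conj hC, h, Matrix.mul_smul, Matrix.smul_mul]

theorem transpose_eigenUnit (hC : C.PosDef) (i j : Fin n) :
    (eigenUnit hC i j).transpose = eigenUnit hC j i := by
  simp [eigenUnit, Matrix.star_eq_conjTranspose, Matrix.conjTranspose_eq_transpose_of_trivial,
    Matrix.mul_assoc]

theorem exists_eq_sum_eigenUnit (hC : C.PosDef) (A : Matrix (Fin n) (Fin n) ℝ) :
    ∃ a : Fin n → Fin n → ℝ, A = ∑ i, ∑ j, a i j • eigenUnit hC i j := by
  have h : (hC.isHermitian.eigenvectorUnitary : Matrix (Fin n) (Fin n) ℝ) *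
      star (hC.isHermitian.eigenvectorUnitary : Matrix (Fin n) (Fin n) ℝ) = 1 :=
    Unitary.coe_mul_star_self hC.isHermitian.eigenvectorUnitary
  set U := (hC.isHermitian.eigenvectorUnitary : Matrix (Fin n) (Fin n) ℝ) with hU
  refine ⟨star U * A * U, ?_⟩
  have h1 : A = U * (star U * A * U) * star U := by
    calc A = (U * star U) * A * (U * star U) := by rw [h, Matrix.one_mul, Matrix.mul_one]
      _ = _ := by simp only [Matrix.mul_assoc]
  conv_lhs => rw [h1, Matrix.matrix_eq_sum_single (star U * A * U)]
  simp only [Matrix.mul_sum, Matrix.sum_mul, eigenUnit, ← hU]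
  refine sum_congr rfl fun i _ => sum_congr rfl fun j _ => ?_
  rw [← Matrix.smul_mul, ← Matrix.mul_smul, Matrix.smul_single, smul_eq_mul, mul_one]

/-- The skew-symmetric matrix `eᵢ eⱼᵀ - eⱼ eᵢᵀ` in an orthonormal basis of eigenvectors: the
infinitesimal rotation in the plane spanned by two principal axes. -/
noncomputable def planeRotation (hC : C.PosDef) (i j : Fin n) : so n :=
  ⟨eigenUnit hC i j - eigenUnit hC j i, by
    rw [mem_so_iff, Matrix.transpose_sub, transpose_eigenUnit, transpose_eigenUnit, neg_sub]⟩

theorem coe_planeRotation (hC : C.PosDef) (i j : Fin n) :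
    (planeRotation hC i j : Matrix (Fin n) (Fin n) ℝ) = eigenUnit hC i j - eigenUnit hC j i := rfl

theorem planeRotation_swap (hC : C.PosDef) (i j : Fin n) :
    planeRotation hC i j = -planeRotation hC j i := by
  ext1
  rw [Submodule.coe_neg, coe_planeRotation, coe_planeRotation, neg_sub]

theorem planeRotation_self (hC : C.PosDef) (i : Fin n) : planeRotation hC i i = 0 := by
  ext1
  rw [coe_planeRotation, sub_self, Submodule.coe_zero]

theorem eq_top_of_planeRotation_mem (hC : C.PosDef) {S : Submodule ℝ (so n)}
    (h : ∀ i j, planeRotation hC i j ∈ S) : S = ⊤ := by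
  rw [Submodule.eq_top_iff']
  intro X
  obtain ⟨a, ha⟩ := exists_eq_sum_eigenUnit hC X.1
  have hX : X = (2⁻¹ : ℝ) • ∑ i, ∑ j, a i j • planeRotation hC i j := by
    ext1
    have h1 : (X : Matrix (Fin n) (Fin n) ℝ) = (2⁻¹ : ℝ) • (X.1 - X.1.transpose) := by
      rw [(mem_so_iff _).1 X.2, sub_neg_eq_add, ← two_smul ℝ, smul_smul,
        inv_mul_cancel₀ two_ne_zero, one_smul]
    rw [h1, Submodule.coe_smul]
    congr 1
    rw [ha]
    simp only [Matrix.transpose_sum, Matrix.transpose_smul, transpose_eigenUnit,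
      ← sum_sub_distrib, ← smul_sub, Submodule.coe_sum, Submodule.coe_smul, coe_planeRotation]
  rw [hX]
  exact S.smul_mem _ (S.sum_mem fun i _ => S.sum_mem fun j _ => S.smul_mem _ (h i j))

theorem inertia_planeRotation (hC : C.PosDef) (i j : Fin n) :
    inertiaEquiv hC (planeRotation hC i j) =
      (hC.isHermitian.eigenvalues i + hC.isHermitian.eigenvalues j) • planeRotation hC i j := by
  ext1
  change (planeRotation hC i j).1 * C + C * (planeRotation hC i j).1 = _
  rw [Submodule.coe_smul, coe_planeRotation, sub_mul, mul_sub, mul_eigenUnit, mul_eigenUnit,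
    eigenUnit_mul, eigenUnit_mul]
  module

/-- For `i ≠ j` the square of a plane rotation is diagonal in the eigenbasis, hence commutes with
`C`: rotations about principal axes are equilibria of the undamped system. -/
theorem eulerBilin_planeRotation_self (hC : C.PosDef) (i j : Fin n) :
    eulerBilin hC (planeRotation hC i j) (planeRotation hC i j) = 0 := by
  rcases eq_or_ne i j with rfl | hij
  · rw [planeRotation_self, map_zero]
  · have h : commSymmMul hC (planeRotation hC i j) (planeRotation hC i j) = 0 := by
      ext1
      rw [coe_commSymmMul, coe_planeRotation]
      simp only [sub_mul, mul_sub, eigenUnit_mul_same, eigenUnit_mul_of_ne hC _ hij,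
        eigenUnit_mul_of_ne hC _ hij.symm, Ring.lie_def, mul_add, add_mul, mul_zero, zero_mul,
        mul_eigenUnit, eigenUnit_mul, Submodule.coe_zero]
      module
    rw [eulerBilin_apply, h, map_zero]

/-- The coefficient of the bilinear Euler map on a pair of adjacent plane rotations. -/
noncomputable def eulerCoeff (hC : C.PosDef) (i j : Fin n) : ℝ :=
  (hC.isHermitian.eigenvalues i - hC.isHermitian.eigenvalues j) /
    (2 * (hC.isHermitian.eigenvalues i + hC.isHermitian.eigenvalues j))

/-- The symmetrized product is `E_ik + E_ki`; the commutator with `C` turns it into `λ_i - λ_k`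
times the rotation, and inverting the inertia operator divides by `λ_i + λ_k`. -/
theorem eulerBilin_planeRotation (hC : C.PosDef) {i j k : Fin n} (hij : i ≠ j) (hjk : j ≠ k)
    (hik : i ≠ k) :
    eulerBilin hC (planeRotation hC i j) (planeRotation hC j k) =
      eulerCoeff hC i k • planeRotation hC i k := by
  rw [eulerBilin_apply, LinearEquiv.symm_apply_eq, map_smul, inertia_planeRotation, smul_smul]
  have hi := hC.eigenvalues_pos i
  have hk := hC.eigenvalues_pos k
  have h : eulerCoeff hC i k * (hC.isHermitian.eigenvalues i + hC.isHermitian.eigenvalues k) =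
      (hC.isHermitian.eigenvalues i - hC.isHermitian.eigenvalues k) / 2 := by
    rw [eulerCoeff]
    field_simp
  rw [h]
  ext1
  rw [coe_commSymmMul, Submodule.coe_smul, coe_planeRotation, coe_planeRotation, coe_planeRotation]
  simp only [sub_mul, mul_sub, eigenUnit_mul_same, eigenUnit_mul_of_ne hC _ hij,
    eigenUnit_mul_of_ne hC _ hij.symm, eigenUnit_mul_of_ne hC _ hjk,
    eigenUnit_mul_of_ne hC _ hjk.symm, eigenUnit_mul_of_ne hC _ hik,
    eigenUnit_mul_of_ne hC _ hik.symm, Ring.lie_def, mul_add, add_mul, mul_zero, zero_mul,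
    mul_eigenUnit, eigenUnit_mul]
  module

theorem eulerCoeff_ne_zero (hC : C.PosDef) (hd : Function.Injective hC.isHermitian.eigenvalues)
    {i j : Fin n} (h : i ≠ j) : eulerCoeff hC i j ≠ 0 := by
  have hi := hC.eigenvalues_pos i
  have hj := hC.eigenvalues_pos j
  exact div_ne_zero (sub_ne_zero.2 (hd.ne h)) (by positivity)

/-- Separates the eigenvalues of the squared bracket operator. After clearing denominators the
difference factors as `(x - y) (a + b) (x y - a b)`, and `x y < a b`; this is where the two largest
eigenvalues are needed. -/
theorem eq_of_mul_div_eq {a b x y : ℝ} (hx : 0 < x) (hy : 0 < y) (hxa : x < a) (hyb : y < b)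
    (h : (a - x) / (2 * (a + x)) * ((b - x) / (2 * (b + x))) =
      (a - y) / (2 * (a + y)) * ((b - y) / (2 * (b + y)))) : x = y := by
  have ha : 0 < a := hx.trans hxa
  have hb : 0 < b := hy.trans hyb
  rw [div_mul_div_comm, div_mul_div_comm, div_eq_div_iff (by positivity) (by positivity)] at h
  have h1 : (x - y) * ((a + b) * (x * y - a * b)) = 0 := by linear_combination h / 8
  have h2 : x * y < a * b := mul_lt_mul'' hxa hyb hx.le hy.le
  rcases mul_eq_zero.1 h1 with h3 | h3
  · exact sub_eq_zero.1 h3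
  · exact absurd h3 (mul_ne_zero (by positivity) (by linarith))

/-- A subspace stable under bracketing with its equilibria is everything as soon as it contains the
rotation in the plane of the two principal axes `i`, `j` with the largest eigenvalues and the sum
of the rotations in the planes of `j` and each of the other axes. -/
theorem eq_top_of_torques_mem (hC : C.PosDef) (hd : Function.Injective hC.isHermitian.eigenvalues)
    {S : Submodule ℝ (so n)}
    (hS : ∀ X ∈ S, ∀ Y ∈ S, eulerBilin hC X X = 0 → eulerBilin hC X Y ∈ S) {i j : Fin n}
    (hij : i ≠ j)
    (hi : ∀ k, k ≠ i → k ≠ j → hC.isHermitian.eigenvalues k < hC.isHermitian.eigenvalues i)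
    (hj : ∀ k, k ≠ i → k ≠ j → hC.isHermitian.eigenvalues k < hC.isHermitian.eigenvalues j)
    (h₁ : planeRotation hC i j ∈ S)
    (h₂ : ∑ k ∈ univ.filter (fun k => k ≠ i ∧ k ≠ j), planeRotation hC j k ∈ S) : S = ⊤ := by
  have hstep : ∀ k l m, k ≠ l → l ≠ m → k ≠ m → planeRotation hC k l ∈ S →
      planeRotation hC l m ∈ S → planeRotation hC k m ∈ S := by
    intro k l m hkl hlm hkm hk hl
    have h := hS _ hk _ hl (eulerBilin_planeRotation_self hC k l)
    rw [eulerBilin_planeRotation hC hkl hlm hkm] at h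
    exact (S.smul_mem_iff (eulerCoeff_ne_zero hC hd hkm)).1 h
  have hswap : ∀ k l, planeRotation hC k l ∈ S → planeRotation hC l k ∈ S := by
    intro k l h
    rw [planeRotation_swap]
    exact S.neg_mem h
  set B : so n →ₗ[ℝ] so n := (eulerBilin hC (planeRotation hC i j)).toLinearMap
  have hB : ∀ X ∈ S, B X ∈ S := fun X hX => hS _ h₁ _ hX (eulerBilin_planeRotation_self hC i j)
  have hjk : ∀ k, k ≠ i → k ≠ j → planeRotation hC j k ∈ S := by
    -- `B` sends `Ω_jk` to a multiple of `Ω_ik` and back, so `B ∘ B` is diagonal on the summands of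
    -- the second torque.
    intro k hki hkj
    refine mem_of_sum_eigenvectors_mem (f := B ∘ₗ B)
      (μ := fun k => -(eulerCoeff hC i k * eulerCoeff hC j k))
      (fun X hX => hB _ (hB X hX)) (univ.filter (fun k => k ≠ i ∧ k ≠ j)) ?_
      (fun k => planeRotation hC j k) ?_ h₂ k (by simp [hki, hkj])
    · intro k hk l hl h
      simp only [coe_filter, mem_univ, true_and, Set.mem_ofPred_eq] at hk hl
      exact hd (eq_of_mul_div_eq (hC.eigenvalues_pos k) (hC.eigenvalues_pos l) (hi k hk.1 hk.2)
        (hj l hl.1 hl.2) (neg_injective h))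
    · intro k hk
      simp only [mem_filter, mem_univ, true_and] at hk
      have e1 : B (planeRotation hC j k) = eulerCoeff hC i k • planeRotation hC i k :=
        eulerBilin_planeRotation hC hij hk.2.symm hk.1.symm
      have e2 : B (planeRotation hC i k) = -(eulerCoeff hC j k • planeRotation hC j k) := by
        rw [← eulerBilin_planeRotation hC hij.symm hk.1.symm hk.2.symm, planeRotation_swap hC j i,
          map_neg, neg_apply, neg_neg]
        rfl
      rw [LinearMap.comp_apply, e1, map_smul, e2, smul_neg, smul_smul, neg_smul]
  have hjall : ∀ k, planeRotation hC j k ∈ S := by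
    intro k
    by_cases hki : k = i
    · exact hki ▸ hswap _ _ h₁
    · by_cases hkj : k = j
      · rw [hkj, planeRotation_self]
        exact S.zero_mem
      · exact hjk k hki hkj
  refine eq_top_of_planeRotation_mem hC fun k l => ?_
  rcases eq_or_ne k l with rfl | hkl
  · rw [planeRotation_self]
    exact S.zero_mem
  rcases eq_or_ne k j with rfl | hkj
  · exact hjall l
  rcases eq_or_ne l j with rfl | hlj
  · exact hswap _ _ (hjall k)
  exact hstep k j l hkj hlj.symm hkl (hswap _ _ (hjall k)) (hjall l)

/-- An injective real function on a finite type with at least two points has two largest values. -/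
theorem exists_two_largest {ι : Type*} [Fintype ι] [DecidableEq ι] [Nontrivial ι] {c : ι → ℝ}
    (hc : Function.Injective c) :
    ∃ i j, i ≠ j ∧ (∀ k, k ≠ i → k ≠ j → c k < c i) ∧ ∀ k, k ≠ i → k ≠ j → c k < c j := by
  obtain ⟨i, -, hi⟩ := exists_max_image (univ : Finset ι) c univ_nonempty
  obtain ⟨j₀, hj₀⟩ := exists_ne i
  obtain ⟨j, hj, hmax⟩ := exists_max_image (univ.erase i) c ⟨j₀, by simp [hj₀]⟩
  refine ⟨i, j, (ne_of_mem_erase hj).symm, fun k hki _ => ?_, fun k hki hkj => ?_⟩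
  · exact (hi k (mem_univ k)).lt_of_ne (hc.ne hki)
  · exact (hmax k (by simp [hki])).lt_of_ne (hc.ne hkj)

end Torques

end RigidBody

theorem theorem1 (n : ℕ) (C : Matrix (Fin n) (Fin n) ℝ) (hC : C.PosDef)
    (hdist : Function.Injective hC.isHermitian.eigenvalues) :
    ∃ G₁ G₂ : RigidBody.so n, ∀ ν : ℝ, 0 ≤ ν →
      RigidBody.GloballyControllable hC ν ![G₁, G₂] := by
  rcases subsingleton_or_nontrivial (Fin n) with hn | hn
  -- For `n ≤ 1` the space `so(n)` is zero.
  · refine ⟨0, 0, fun ν _ =>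
      RigidBody.globallyControllable_of_forall_submodule hC ν _ fun S _ _ =>
        RigidBody.eq_top_of_planeRotation_mem hC fun i j => ?_⟩
    rw [Subsingleton.elim j i, RigidBody.planeRotation_self]
    exact S.zero_mem
  · obtain ⟨i, j, hij, hi, hj⟩ := RigidBody.exists_two_largest hdist
    refine ⟨RigidBody.planeRotation hC i j,
      ∑ k ∈ Finset.univ.filter (fun k => k ≠ i ∧ k ≠ j), RigidBody.planeRotation hC j k,
      fun ν _ => RigidBody.globallyControllable_of_forall_submodule hC ν _ fun S hG hS =>
        RigidBody.eq_top_of_torques_mem hC hdist hS hij hi hj ?_ ?_⟩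
    · simpa using hG 0
    · simpa using hG 1
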